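/- Let $(\mathbb K,\partial)$ be a differential field with field of constants $\Bbbk=\{c\in\mathbb K:\partial c=0\}$, and write $\otimes=\otimes_{\Bbbk}$. Let $U=\mathbb K[Y;\partial]=\bigoplus_{n\ge 0}Y^n\mathbb K$ be the Ore extension, with $xY=Yx+\partial(x)$ for $x\in\mathbb K$. Let $U^*=\mathrm{Hom}_{\mathbb K}(U,\mathbb K)$ be the space of right $\mathbb K$-linear maps, with the convolution product for the right $\mathbb K$-linear comultiplication $\Delta(Y^n)=\sum_k\binom nk Y^k\otimes_{\mathbb K}Y^{n-k}$, regarded as a $(\mathbb K\otimes\mathbb K)$-algebra through $x\otimes 1\mapsto x\varepsilon$ and $1\otimes x\mapsto\mu(x)$, where $\varepsilon(Y^n)=\delta_{0,n}$ and $\mu(x)(Y^n)=\partial^n(x)$. Let $U^\circ$ be the quotient of $\bigoplus_{(M,\partial_M)}M^*\otimes_{T_M}M$ by the relations $\psi\otimes f(x)=\psi f\otimes x$, where $(M,\partial_M)$ ranges over the finite-dimensional differential right $\mathbb K$-vector spaces ($\partial_M$ is $\Bbbk$-linear with $\partial_M(mx)=\partial_M(m)x+m\,\partial(x)$), $M^*=\mathrm{Hom}_{\mathbb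 K}(M,\mathbb K)$, $T_M$ is the algebra of differential endomorphisms of $M$, $f:M\to N$ is any morphism of differential spaces, $\psi\in N^*$ and $x\in M$. It is a commutative ring under $\overline{\varphi\otimes p}\cdot\overline{\psi\otimes q}=\overline{(\psi\diamond\varphi)\otimes(q\otimes_{\mathbb K}p)}$ with $(\psi\diamond\varphi)(q\otimes_{\mathbb K} p)=\varphi(\psi(q)p)$, and a $(\mathbb K\otimes\mathbb K)$-algebra through $x\otimes y\mapsto\overline{x\otimes y}\in\overline{\mathbb K^*\otimes_{\Bbbk}\mathbb K}$. Let $\zeta:U^\circ\to U^*$ be the canonical map $\zeta(\overline{\varphi\otimes m})\big(\sum_iY^ic_i\big)=\varphi\big(\sum_i\partial_M^i(m)c_i\big)$. Then the functionals $f\in U^*$ that vanish on some principal right ideal of $U$ of finite codimension (as a right $\mathbb K$-subspace) form a $(\mathbb K\otimes\mathbb K)$-subalgebra $S$ of $U^*$; $S$ is also the set of the functionals that vanish on some right ideal of finite codimension; and $\zeta$ is an isomorphism of $(\mathbb K\otimes\mathbb K)$-algebras from $U^\circ$ onto $S$. -/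

import Mathlib

open scoped TensorProduct

namespace DiffOps

universe u

open scoped Differential
open Polynomial

noncomputable section

variable (K : Type u) [Field K] [Differential K]

/-! ### The field of constants -/

/-- The subfield `{c ∈ K | ∂ c = 0}` of constants of the differential field `K`. -/
def constantsSubfield : Subfield K where
  carrier := {c | c′ = 0}
  mul_mem' := by
    intro a b ha hb
    simp only [Set.mem_ofPred_eq] at *
    simp [ha, hb]
  one_mem' := by simp
  add_mem' := by
    intro a b ha hb
    simp only [Set.mem_ofPred_eq] at *
    simp [ha, hb]
  zero_mem' := by simp
  neg_mem' := by
    intro a ha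
    simp only [Set.mem_ofPred_eq] at *
    simp [ha]
  inv_mem' := by
    intro a ha
    simp only [Set.mem_ofPred_eq] at *
    by_cases h : a = 0
    · simp [h]
    · have h1 : (a * a⁻¹)′ = 0 := by rw [mul_inv_cancel₀ h]; simp
      rw [Derivation.leibniz, ha] at h1
      simpa [h] using h1

/-- The field of constants `𝕜` as a type; it acts on `K` by the inclusion. -/
def Constants : Type u := constantsSubfield K

variable {K}

instance : Field (Constants K) := inferInstanceAs (Field (constantsSubfield K))

instance : Algebra (Constants K) K := inferInstanceAs (Algebra (constantsSubfield K) K)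

lemma deriv_const (c : Constants K) : (algebraMap (Constants K) K c)′ = 0 := c.2

lemma mem_range_algebraMap {x : K} : x ∈ (algebraMap (Constants K) K).range ↔ x′ = 0 :=
  ⟨by rintro ⟨c, rfl⟩; exact deriv_const c, fun h => ⟨⟨x, h⟩, rfl⟩⟩

/-! ### The Ore extension `U = K[Y; ∂]` -/

variable (K) in
/-- The skew polynomial ring `U = K[Y; ∂] = ⨁ Yⁱ K`, coefficients on the right, with
`x Y = Y x + ∂ x`. The additive group is that of the polynomials in one variable (the coefficient
sequence of `∑ Yⁱ cᵢ` is `(cᵢ)`); the multiplication is the one of `OreExt.mul`. -/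
def OreExt : Type u := K[X]

namespace OreExt

instance : AddCommGroup (OreExt K) := inferInstanceAs (AddCommGroup K[X])

/-- The *right* `K`-vector space structure of `U`: `c • ∑ Yⁱ cᵢ = ∑ Yⁱ (cᵢ c)`.
(As `K` is commutative, right `K`-vector spaces are written as `K`-modules.) -/
instance : Module K (OreExt K) := inferInstanceAs (Module K K[X])

variable (K) in
/-- The basis `(Yⁿ)` of the right `K`-vector space `U`. -/
def basis : Module.Basis ℕ K (OreExt K) := Polynomial.basisMonomials K

/-- The multiplication of `K[Y; ∂]`:
`(∑ᵢ Yⁱ aᵢ) (∑ⱼ Yʲ bⱼ) = ∑ᵢ ∑ⱼ ∑_{k ≤ j} Y^{i+k} (j choose k) ∂^{j-k}(aᵢ) bⱼ`. -/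
def mul (p q : K[X]) : K[X] :=
  p.sum fun i a => q.sum fun j b =>
    ∑ k ∈ Finset.range (j + 1),
      monomial (i + k) ((j.choose k : K) * (fun x : K => x′)^[j - k] a * b)

lemma iter_zero (n : ℕ) : (fun x : K => x′)^[n] 0 = 0 :=
  Function.iterate_fixed (by simp) n

lemma iter_add (n : ℕ) (a b : K) : (fun x : K => x′)^[n] (a + b) =
    (fun x : K => x′)^[n] a + (fun x : K => x′)^[n] b := by
  induction n generalizing a b with
  | zero => rfl
  | succ n ih => simp [Function.iterate_succ_apply, ih]

lemma mul_monomial (i j : ℕ) (a b : K) : mul (monomial i a) (monomial j b) =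
    ∑ k ∈ Finset.range (j + 1),
      monomial (i + k) ((j.choose k : K) * (fun x : K => x′)^[j - k] a * b) := by
  unfold mul
  rw [sum_monomial_index, sum_monomial_index]
  · simp
  · simp [sum_def]

lemma add_mul' (p q r : K[X]) : mul (p + q) r = mul p r + mul q r := by
  unfold mul
  rw [sum_add_index]
  · intro i; simp [sum_def]
  · intro i a b
    simp only [sum_def, ← Finset.sum_add_distrib, iter_add, mul_add, add_mul, map_add]

lemma mul_add' (p q r : K[X]) : mul p (q + r) = mul p q + mul p r := by
  unfold mul
  have : ∀ (i : ℕ) (a : K), ((q + r).sum fun j b => ∑ k ∈ Finset.range (j + 1),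
      monomial (i + k) ((j.choose k : K) * (fun x : K => x′)^[j - k] a * b)) =
      (q.sum fun j b => ∑ k ∈ Finset.range (j + 1),
      monomial (i + k) ((j.choose k : K) * (fun x : K => x′)^[j - k] a * b)) +
      (r.sum fun j b => ∑ k ∈ Finset.range (j + 1),
      monomial (i + k) ((j.choose k : K) * (fun x : K => x′)^[j - k] a * b)) := by
    intro i a
    rw [sum_add_index]
    · intro j; simp
    · intro j b c
      simp only [← Finset.sum_add_distrib, mul_add, map_add]
  simp only [this]
  simp only [sum_def, Finset.sum_add_distrib]

lemma zero_mul' (q : K[X]) : mul 0 q = 0 := by simp [mul]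

lemma mul_zero' (q : K[X]) : mul q 0 = 0 := by simp [mul, sum_def]

lemma X_mul_mul (p q : K[X]) : mul (X * p) q = X * mul p q := by
  induction p using Polynomial.induction_on' with
  | add p r hp hr => rw [mul_add, add_mul', hp, hr, add_mul', mul_add]
  | monomial i a =>
    induction q using Polynomial.induction_on' with
    | add q r hq hr => rw [mul_add', hq, hr, mul_add', mul_add]
    | monomial j b =>
      rw [X_mul_monomial, mul_monomial, mul_monomial, Finset.mul_sum]
      refine Finset.sum_congr rfl fun k _ => ?_
      rw [X_mul_monomial, add_right_comm]

lemma mul_C_right (p : K[X]) (b : K) : mul p (C b) = p * C b := by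
  induction p using Polynomial.induction_on' with
  | add p r hp hr => rw [add_mul', hp, hr, add_mul]
  | monomial i a =>
    rw [← monomial_zero_left, mul_monomial]
    simp [monomial_mul_C]

lemma mul_mul_C (p q : K[X]) (b : K) : mul p (q * C b) = mul p q * C b := by
  induction p using Polynomial.induction_on' with
  | add p r hp hr => rw [add_mul', hp, hr, add_mul', add_mul]
  | monomial i a =>
    induction q using Polynomial.induction_on' with
    | add q r hq hr => rw [add_mul, mul_add', hq, hr, mul_add', add_mul]
    | monomial j c =>
      rw [monomial_mul_C, mul_monomial, mul_monomial, Finset.sum_mul]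
      refine Finset.sum_congr rfl fun k _ => ?_
      rw [monomial_mul_C]
      congr 1; ring

lemma one_mul' (q : K[X]) : mul 1 q = q := by
  induction q using Polynomial.induction_on' with
  | add p r hp hr => rw [mul_add', hp, hr]
  | monomial j b =>
    rw [← monomial_zero_one, mul_monomial, Finset.sum_range_succ, Finset.sum_eq_zero]
    · simp
    · intro k hk
      have hk : j - k = (j - k - 1) + 1 := by have := Finset.mem_range.1 hk; omega
      rw [hk, Function.iterate_succ_apply]
      simp

lemma mul_one' (q : K[X]) : mul q 1 = q := by
  rw [← C_1, mul_C_right, C_1, mul_one]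

/-- The defining commutation rule: `a (Y q) = Y (a q) + (∂ a) q`. -/
lemma C_mul_X_mul (a : K) (q : K[X]) :
    mul (C a) (X * q) = X * mul (C a) q + mul (C a′) q := by
  induction q using Polynomial.induction_on' with
  | add p r hp hr => rw [mul_add, mul_add', hp, hr, mul_add', mul_add', mul_add]; abel
  | monomial j b =>
    rw [X_mul_monomial, ← monomial_zero_left, ← monomial_zero_left, mul_monomial, mul_monomial,
      mul_monomial, Finset.sum_range_succ', Finset.mul_sum]
    simp only [X_mul_monomial]
    have key : ∀ k ∈ Finset.range (j + 1),
        monomial (0 + (k + 1)) (((j + 1).choose (k + 1) : K) *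
          (fun x : K => x′)^[j + 1 - (k + 1)] a * b) =
        monomial (0 + k + 1) ((j.choose k : K) * (fun x : K => x′)^[j - k] a * b) +
        monomial (0 + (k + 1)) ((j.choose (k + 1) : K) *
          (fun x : K => x′)^[j - k] a * b) := by
      intro k _
      rw [Nat.add_sub_add_right, Nat.choose_succ_succ, add_assoc 0 k 1, ← map_add]
      congr 1; push_cast; ring
    rw [Finset.sum_congr rfl key, Finset.sum_add_distrib, add_assoc]
    congr 1
    rw [Finset.sum_range_succ, Finset.sum_range_succ' _ j]
    simp only [Nat.choose_succ_self, Nat.cast_zero, zero_mul, map_zero, add_zero]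
    congr 1
    swap
    · simp
    refine Finset.sum_congr rfl fun k hk => ?_
    have hk : j - k = (j - (k + 1)) + 1 := by have := Finset.mem_range.1 hk; omega
    rw [hk, Function.iterate_succ_apply]

lemma C_mul_C_mul (a b : K) (q : K[X]) : mul (C a) (mul (C b) q) = mul (C (a * b)) q := by
  have h0 : ∀ (j : ℕ) (a b : K), mul (C a) (mul (C b) (X ^ j)) = mul (C (a * b)) (X ^ j) := by
    intro j
    induction j with
    | zero =>
      intro a b
      rw [pow_zero, ← C_1, mul_C_right, mul_C_right]
      simp only [← C_mul, mul_one, mul_C_right]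
    | succ j ih =>
      intro a b
      rw [pow_succ', C_mul_X_mul, mul_add', C_mul_X_mul, C_mul_X_mul, ih, ih, ih,
        Derivation.leibniz, add_assoc, ← add_mul', ← C_add]
      simp only [smul_eq_mul]
      congr 3
      ring
  induction q using Polynomial.induction_on' with
  | add p r hp hr => rw [mul_add', mul_add', hp, hr, mul_add']
  | monomial j c =>
    rw [← C_mul_X_pow_eq_monomial, mul_comm (C c), mul_mul_C, mul_mul_C, mul_mul_C, h0]

lemma mul_assoc' (p q r : K[X]) : mul (mul p q) r = mul p (mul q r) := by
  have hC : ∀ (j : ℕ) (a b : K),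
      mul (mul (C a) (monomial j b)) r = mul (C a) (mul (monomial j b) r) := by
    intro j
    induction j with
    | zero =>
      intro a b
      rw [monomial_zero_left, mul_C_right, ← C_mul, C_mul_C_mul]
    | succ j ih =>
      intro a b
      rw [← X_mul_monomial, C_mul_X_mul, add_mul', X_mul_mul, X_mul_mul, C_mul_X_mul, ih, ih]
  have hC' : ∀ a : K, mul (mul (C a) q) r = mul (C a) (mul q r) := by
    intro a
    induction q using Polynomial.induction_on' with
    | add p s hp hs => rw [mul_add', add_mul', hp, hs, add_mul', mul_add']
    | monomial j b => exact hC j a b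
  induction p using Polynomial.induction_on' with
  | add p s hp hs => rw [add_mul', add_mul', hp, hs, add_mul']
  | monomial i a =>
    induction i with
    | zero => exact hC' a
    | succ i ih => rw [← X_mul_monomial, X_mul_mul, X_mul_mul, X_mul_mul, ih]

instance : Ring (OreExt K) :=
  { (inferInstance : AddCommGroup (OreExt K)) with
    mul := mul
    one := (1 : K[X])
    mul_assoc := mul_assoc'
    one_mul := one_mul'
    mul_one := mul_one'
    left_distrib := mul_add'
    right_distrib := add_mul'
    zero_mul := zero_mul'
    mul_zero := mul_zero' }

/-- The variable `Y` of `U`. -/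
def Y : OreExt K := (X : K[X])

/-- The inclusion `τ : K → U`. -/
def of : K →+* OreExt K where
  toFun a := (C a : K[X])
  map_one' := rfl
  map_zero' := C_0
  map_mul' a b := by
    change (C (a * b) : K[X]) = mul (C a) (C b)
    rw [mul_C_right, C_mul]
  map_add' _ _ := C_add

lemma of_mul_Y (a : K) : of a * Y = Y * of a + of a′ := by
  have h := C_mul_X_mul a 1
  rw [mul_one, ← C_1, mul_C_right, mul_C_right, C_1, mul_one, mul_one] at h
  change mul (C a) X = mul X (C a) + C a′
  rw [h, mul_C_right]

lemma smul_eq (c : K) (p : OreExt K) : c • p = p * of c := by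
  have h : ∀ q : K[X], c • q = mul q (C c) := fun q => by
    rw [mul_C_right, smul_eq_C_mul, mul_comm]
  exact h p

lemma basis_eq (n : ℕ) : basis K n = (Y : OreExt K) ^ n := by
  induction n with
  | zero => simp [basis]; rfl
  | succ n ih =>
    rw [pow_succ', ← ih]
    have h : (monomial (n + 1) 1 : K[X]) = mul X (monomial n 1) := by
      have h := X_mul_mul (1 : K[X]) (monomial n 1)
      rw [mul_one, one_mul', X_mul_monomial] at h
      exact h.symm
    exact h

@[elab_as_elim]
lemma induction {P : OreExt K → Prop} (u : OreExt K) (add : ∀ a b, P a → P b → P (a + b))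
    (smul : ∀ (n : ℕ) (c : K), P (c • (Y : OreExt K) ^ n)) : P u := by
  refine Polynomial.induction_on' (motive := P) u add fun n c => ?_
  have h : (monomial n c : K[X]) = c • (monomial n 1 : K[X]) := by
    rw [smul_monomial, smul_eq_mul, mul_one]
  have h2 := smul n c
  rw [← basis_eq] at h2
  rw [h]
  exact h2

/-- Left multiplications of `U` are right `K`-linear. -/
instance : SMulCommClass K (OreExt K) (OreExt K) where
  smul_comm c p q := by simp only [smul_eq, smul_eq_mul, mul_assoc]

/-! ### The comultiplication of `U` and the convolution ring `U*` -/

variable (K) in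
/-- The comultiplication `Δ(Yⁿ) = ∑ (n choose k) Yᵏ ⊗ Yⁿ⁻ᵏ`, extended right `K`-linearly; the
tensor product is that of `U` with itself as a symmetric `K`-bimodule through the right action. -/
def comul : OreExt K →ₗ[K] OreExt K ⊗[K] OreExt K :=
  (basis K).constr K fun n =>
    ∑ k ∈ Finset.range (n + 1), n.choose k • (basis K k ⊗ₜ[K] basis K (n - k))

variable (K) in
/-- The counit `ε(Yⁿ) = δ_{0,n}`, extended right `K`-linearly. -/
def counit : OreExt K →ₗ[K] K :=
  (basis K).constr K fun n => if n = 0 then 1 else 0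

variable (K) in
/-- An auxiliary description of `comul` on commutative polynomials. -/
def comulAux : K[X] →ₐ[K] K[X] ⊗[K] K[X] := aeval (X ⊗ₜ 1 + 1 ⊗ₜ X)

lemma comul_eq : comul K = (comulAux K).toLinearMap := by
  refine (basis K).ext fun n => ?_
  rw [comul, Module.Basis.constr_basis]
  change _ = comulAux K (monomial n 1)
  rw [monomial_one_right_eq_X_pow, comulAux, map_pow, aeval_X,
    Commute.add_pow (by rw [Commute, SemiconjBy, mul_comm])]
  refine Finset.sum_congr rfl fun k _ => ?_
  rw [Algebra.TensorProduct.tmul_pow, Algebra.TensorProduct.tmul_pow,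
    Algebra.TensorProduct.tmul_mul_tmul, one_pow, one_pow, one_mul, mul_one, mul_comm,
    ← nsmul_eq_mul, ← monomial_one_right_eq_X_pow, ← monomial_one_right_eq_X_pow]
  rfl

variable (K) in
/-- An auxiliary description of `counit` on commutative polynomials. -/
def counitAux : K[X] →ₐ[K] K := aeval 0

lemma counit_eq : counit K = (counitAux K).toLinearMap := by
  refine (basis K).ext fun n => ?_
  rw [counit, Module.Basis.constr_basis]
  change _ = counitAux K (monomial n 1)
  rw [monomial_one_right_eq_X_pow, counitAux, map_pow, aeval_X, zero_pow_eq]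

instance : Coalgebra K (OreExt K) where
  comul := comul K
  counit := counit K
  coassoc := by
    rw [comul_eq]
    have h : ((Algebra.TensorProduct.assoc K K K K[X] K[X] K[X]).toAlgHom.comp
        (Algebra.TensorProduct.map (comulAux K) (AlgHom.id K K[X]))).comp (comulAux K) =
        (Algebra.TensorProduct.map (AlgHom.id K K[X]) (comulAux K)).comp (comulAux K) := by
      ext
      simp [comulAux, TensorProduct.tmul_add, TensorProduct.add_tmul,
        Algebra.TensorProduct.one_def, add_assoc]
    exact congrArg AlgHom.toLinearMap h
  rTensor_counit_comp_comul := by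
    rw [comul_eq, counit_eq]
    have h : (Algebra.TensorProduct.map (counitAux K) (AlgHom.id K K[X])).comp (comulAux K) =
        Algebra.TensorProduct.includeRight := by
      ext; simp [comulAux, counitAux]
    exact congrArg AlgHom.toLinearMap h
  lTensor_counit_comp_comul := by
    rw [comul_eq, counit_eq]
    have h : (Algebra.TensorProduct.map (AlgHom.id K K[X]) (counitAux K)).comp (comulAux K) =
        Algebra.TensorProduct.includeLeft := by
      ext; simp [comulAux, counitAux]
    exact congrArg AlgHom.toLinearMap h

instance : Coalgebra.IsCocomm K (OreExt K) where
  comm_comp_comul := by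
    change _ ∘ₗ comul K = comul K
    rw [comul_eq]
    have h : (Algebra.TensorProduct.comm K K[X] K[X]).toAlgHom.comp (comulAux K) =
        comulAux K := by
      ext; simp [comulAux, add_comm]
    exact congrArg AlgHom.toLinearMap h

end OreExt

variable (K) in
/-- `U* = Hom_K(U, K)`, the right `K`-linear maps `U → K`, as a commutative ring under the
convolution product `(f * g)(u) = ∑ f(u₁) g(u₂)`. -/
abbrev UDual : Type u := WithConv (OreExt K →ₗ[K] K)


/-! ### Differential `K`-vector spaces -/

/-- The rule `∂_A (a x) = ∂_A(a) x + a ∂(x)`. -/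
def IsDer {A : Type*} [AddCommGroup A] [Module K A] (d : A →+ A) : Prop :=
  ∀ (x : K) (a : A), d (x • a) = x • d a + x′ • a

section TensorDer

variable {A B C : Type*} [AddCommGroup A] [Module K A] [AddCommGroup B] [Module K B]
  [AddCommGroup C] [Module K C]

/-- The derivation `∂(a ⊗ b) = ∂a ⊗ b + a ⊗ ∂b` of the tensor product `A ⊗_K B`. -/
def tensorDer (d : A →+ A) (hd : IsDer (K := K) d) (e : B →+ B) (he : IsDer (K := K) e) :
    (A ⊗[K] B) →+ (A ⊗[K] B) :=
  TensorProduct.liftAddHom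
    { toFun := fun a =>
        { toFun := fun b => d a ⊗ₜ[K] b + a ⊗ₜ[K] e b
          map_zero' := by simp
          map_add' := fun a b => by simp only [map_add, TensorProduct.tmul_add]; abel }
      map_zero' := by ext; simp
      map_add' := fun a b => by
        ext n
        simp only [map_add, TensorProduct.add_tmul, AddMonoidHom.coe_mk, ZeroHom.coe_mk,
          AddMonoidHom.add_apply]
        abel }
    (fun r m n => by
      simp only [AddMonoidHom.coe_mk, ZeroHom.coe_mk, hd r, he r,
        TensorProduct.add_tmul, TensorProduct.tmul_add, TensorProduct.smul_tmul]
      abel)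

variable {d : A →+ A} {hd : IsDer (K := K) d} {e : B →+ B} {he : IsDer (K := K) e}
  {g : C →+ C} {hg : IsDer (K := K) g}

@[simp] lemma tensorDer_tmul (a : A) (b : B) :
    tensorDer d hd e he (a ⊗ₜ b) = d a ⊗ₜ[K] b + a ⊗ₜ[K] e b := rfl

lemma isDer_tensorDer : IsDer (K := K) (tensorDer d hd e he) := by
  intro x t
  induction t with
  | zero => simp
  | add a b ha hb => simp only [smul_add, map_add, ha, hb]; abel
  | tmul m n =>
    rw [TensorProduct.smul_tmul', tensorDer_tmul, tensorDer_tmul, hd,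
      TensorProduct.add_tmul, TensorProduct.smul_tmul', smul_add, TensorProduct.smul_tmul',
      TensorProduct.smul_tmul']
    abel

lemma assoc_tensorDer (t : (A ⊗[K] B) ⊗[K] C) :
    TensorProduct.assoc K A B C (tensorDer (tensorDer d hd e he) isDer_tensorDer g hg t) =
      tensorDer d hd (tensorDer e he g hg) isDer_tensorDer (TensorProduct.assoc K A B C t) := by
  induction t with
  | zero => simp
  | add a b ha hb => simp only [map_add, ha, hb]
  | tmul s p =>
    rw [tensorDer_tmul]
    induction s with
    | zero => simp
    | add a b ha hb =>
      simp only [TensorProduct.add_tmul, map_add] at ha hb ⊢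
      rw [← ha, ← hb]; abel
    | tmul m n => simp [TensorProduct.add_tmul, TensorProduct.tmul_add, add_assoc]

lemma comm_tensorDer (t : A ⊗[K] B) :
    TensorProduct.comm K A B (tensorDer d hd e he t) =
      tensorDer e he d hd (TensorProduct.comm K A B t) := by
  induction t with
  | zero => simp
  | add a b ha hb => simp only [map_add, ha, hb]
  | tmul m n => simp [add_comm]

lemma lid_tensorDer {δ : K →+ K} (hδ : IsDer (K := K) δ) (h : ∀ x, δ x = x′) (t : K ⊗[K] B) :
    TensorProduct.lid K B (tensorDer δ hδ e he t) = e (TensorProduct.lid K B t) := by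
  induction t with
  | zero => simp
  | add a b ha hb => simp only [map_add, ha, hb]
  | tmul x m => simp [he x, h, add_comm]

lemma map_tensorDer {A' B' : Type*} [AddCommGroup A'] [Module K A'] [AddCommGroup B']
    [Module K B'] {d' : A' →+ A'} {hd' : IsDer (K := K) d'} {e' : B' →+ B'}
    {he' : IsDer (K := K) e'} (f : A →ₗ[K] A') (hf : ∀ a, f (d a) = d' (f a))
    (g : B →ₗ[K] B') (hg : ∀ a, g (e a) = e' (g a)) (t : A ⊗[K] B) :
    TensorProduct.map f g (tensorDer d hd e he t) =
      tensorDer d' hd' e' he' (TensorProduct.map f g t) := by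
  induction t with
  | zero => simp
  | add a b ha hb => simp only [map_add, ha, hb]
  | tmul m n => simp [hf, hg]

/-- `(ψ ◇ φ)(q ⊗ p) = φ(ψ(q) p)`. -/
def dia (ψ : Module.Dual K B) (φ : Module.Dual K A) : Module.Dual K (B ⊗[K] A) :=
  TensorProduct.lift
    (LinearMap.mk₂ K (fun q p => φ (ψ q • p))
      (fun a b p => by simp [add_mul]) (fun c a p => by simp [mul_assoc])
      (fun a p q => by simp) (fun c a p => by simp [mul_left_comm]))

@[simp] lemma dia_tmul (ψ : Module.Dual K B) (φ : Module.Dual K A)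
    (q : B) (p : A) : dia ψ φ (q ⊗ₜ[K] p) = ψ q * φ p := by
  simp [dia]

end TensorDer

variable (K) in
/-- A finite-dimensional differential `K`-vector space: a finite-dimensional (right) `K`-vector
space `M` with `∂_M : M → M` satisfying `∂_M (m x) = ∂_M(m) x + m ∂(x)`. (Additivity and
this rule imply that `∂_M` is linear over the constants, see `FinDiffMod.der_const_smul`.) -/
structure FinDiffMod : Type (u + 1) where
  carrier : Type u
  [addCommGroup : AddCommGroup carrier]
  [module : Module K carrier]
  [finite : Module.Finite K carrier]
  der : carrier →+ carrier
  leibniz : ∀ (x : K) (m : carrier), der (x • m) = x • der m + x′ • m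

namespace FinDiffMod

instance : CoeSort (FinDiffMod K) (Type u) := ⟨carrier⟩

attribute [instance] addCommGroup module finite

/-- The constants act through `K`. -/
instance (M : FinDiffMod K) : Module (Constants K) M :=
  Module.compHom M (algebraMap (Constants K) K)

instance (M : FinDiffMod K) : IsScalarTower (Constants K) K M where
  smul_assoc c x m := by rw [Algebra.smul_def, mul_smul]; rfl

lemma const_smul (M : FinDiffMod K) (c : Constants K) (m : M) :
    c • m = algebraMap (Constants K) K c • m := rfl

lemma der_const_smul (M : FinDiffMod K) (c : Constants K) (m : M) :
    M.der (c • m) = c • M.der m := by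
  rw [const_smul, M.leibniz, deriv_const, zero_smul, add_zero, const_smul]

lemma iter_const_smul (M : FinDiffMod K) (n : ℕ) (c : Constants K) (m : M) :
    M.der^[n] (c • m) = c • M.der^[n] m := by
  induction n generalizing m with
  | zero => rfl
  | succ n ih => rw [Function.iterate_succ_apply, der_const_smul, ih, Function.iterate_succ_apply]

/-- Morphisms of differential `K`-vector spaces. -/
structure Hom (M N : FinDiffMod K) where
  toLin : M →ₗ[K] N
  comm : ∀ m, toLin (M.der m) = N.der (toLin m)

variable (K) in
/-- The unit object: `K` with `∂`. -/
def unit : FinDiffMod K where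
  carrier := K
  der := (Differential.deriv : Derivation ℤ K K).toLinearMap.toAddMonoidHom
  leibniz x m := by
    change (x * m)′ = x * m′ + x′ * m
    rw [Derivation.leibniz, smul_eq_mul, smul_eq_mul, mul_comm m]

/-- The tensor product `M ⊗_K N` of differential `K`-vector spaces. -/
def tensor (M N : FinDiffMod K) : FinDiffMod K where
  carrier := M ⊗[K] N
  der := tensorDer M.der M.leibniz N.der N.leibniz
  leibniz := isDer_tensorDer

/-- The element `q ⊗ p` of `M ⊗_K N`. -/
def tmul {M N : FinDiffMod K} (q : M) (p : N) : M.tensor N := (q ⊗ₜ[K] p : M ⊗[K] N)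

/-- The functional `ψ ◇ φ` on `N ⊗_K M`. -/
def diamond {M N : FinDiffMod K} (ψ : Module.Dual K N) (φ : Module.Dual K M) :
    Module.Dual K (N.tensor M) := dia ψ φ

lemma diamond_tmul {M N : FinDiffMod K} (ψ : Module.Dual K N) (φ : Module.Dual K M)
    (q : N) (p : M) : diamond ψ φ (tmul q p) = ψ q * φ p := dia_tmul ψ φ q p

lemma dual_ext {M N : FinDiffMod K} {f g : Module.Dual K (M.tensor N)}
    (h : ∀ m n, f (tmul m n) = g (tmul m n)) : f = g :=
  TensorProduct.ext' (M := M) (N := N) h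

variable (K) in
/-- An element of `K`, as an element of the unit object. -/
def ofK (x : K) : unit K := x

variable (K) in
/-- The functional `y ↦ x y` on the unit object. -/
def scal (x : K) : Module.Dual K (unit K) := x • (LinearMap.id : K →ₗ[K] K)

/-- The action `m ◁ u` of `U` on `M`, given by `m ◁ Y = ∂_M(m)`: so `m ◁ ∑ Yⁱ cᵢ = ∑ ∂ⁱ(m) cᵢ`,
as a `K`-linear map in `u`. -/
def act (M : FinDiffMod K) (m : M) : OreExt K →ₗ[K] M :=
  (OreExt.basis K).constr K fun n => M.der^[n] m

lemma act_basis (M : FinDiffMod K) (m : M) (n : ℕ) :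
    M.act m (OreExt.basis K n) = M.der^[n] m :=
  (OreExt.basis K).constr_basis K _ n

lemma act_add (M : FinDiffMod K) (m m' : M) : M.act (m + m') = M.act m + M.act m' :=
  (OreExt.basis K).ext fun n => by
    rw [LinearMap.add_apply, act_basis, act_basis, act_basis, iterate_map_add]

lemma act_pow (M : FinDiffMod K) (m : M) (n : ℕ) : M.act m (OreExt.Y ^ n) = M.der^[n] m := by
  rw [← OreExt.basis_eq, act_basis]

lemma act_mul_Y (M : FinDiffMod K) (m : M) (u : OreExt K) :
    M.act m (u * OreExt.Y) = M.der (M.act m u) := by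
  induction u using OreExt.induction with
  | add a b ha hb => rw [add_mul, map_add, map_add, map_add, ha, hb]
  | smul n c =>
    rw [OreExt.smul_eq, mul_assoc, OreExt.of_mul_Y, mul_add, ← mul_assoc, ← pow_succ,
      ← OreExt.smul_eq, ← OreExt.smul_eq, ← OreExt.smul_eq, map_add, map_smul, map_smul, map_smul,
      act_pow, act_pow, M.leibniz, Function.iterate_succ_apply']

/-- `m ◁ u` is indeed a right action of the ring `U`. -/
lemma act_act (M : FinDiffMod K) (m : M) (u v : OreExt K) :
    M.act (M.act m u) v = M.act m (u * v) := by
  induction v using OreExt.induction with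
  | add a b ha hb => rw [mul_add, map_add, map_add, ha, hb]
  | smul n c =>
    rw [mul_smul_comm, map_smul, map_smul, act_pow]
    congr 1
    induction n with
    | zero => rw [pow_zero, mul_one]; rfl
    | succ n ih => rw [pow_succ, ← mul_assoc, act_mul_Y, ← ih, Function.iterate_succ_apply']

lemma Hom.iter_comm {M N : FinDiffMod K} (f : Hom M N) (n : ℕ) (m : M) :
    N.der^[n] (f.toLin m) = f.toLin (M.der^[n] m) := by
  induction n generalizing m with
  | zero => rfl
  | succ n ih => rw [Function.iterate_succ_apply, ← f.comm, ih, Function.iterate_succ_apply]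

/-- The tensor product of two morphisms. -/
def Hom.tensor {M M' N N' : FinDiffMod K} (f : Hom M M') (g : Hom N N') :
    Hom (M.tensor N) (M'.tensor N') where
  toLin := TensorProduct.map f.toLin g.toLin
  comm := map_tensorDer (hd := M.leibniz) (he := N.leibniz) (hd' := M'.leibniz)
    (he' := N'.leibniz) f.toLin f.comm g.toLin g.comm

/-- The identity. -/
def Hom.id (M : FinDiffMod K) : Hom M M := ⟨LinearMap.id, fun _ => rfl⟩

/-- The symmetry. -/
def Hom.swap (M N : FinDiffMod K) : Hom (M.tensor N) (N.tensor M) where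
  toLin := (TensorProduct.comm K M N).toLinearMap
  comm := comm_tensorDer (hd := M.leibniz) (he := N.leibniz)

/-- The associativity constraint. -/
def Hom.assoc (M N P : FinDiffMod K) :
    Hom ((M.tensor N).tensor P) (M.tensor (N.tensor P)) where
  toLin := (TensorProduct.assoc K M N P).toLinearMap
  comm := assoc_tensorDer (hd := M.leibniz) (he := N.leibniz) (hg := P.leibniz)

/-- The unit constraint. -/
def Hom.lid (M : FinDiffMod K) : Hom ((unit K).tensor M) M where
  toLin := (TensorProduct.lid K M).toLinearMap
  comm := lid_tensorDer (K := K) (he := M.leibniz) (unit K).leibniz fun _ => rfl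

end FinDiffMod

/-! ### The finite dual `U°` -/

instance : DecidableEq (FinDiffMod K) := Classical.decEq _

variable (K) in
/-- The direct sum of the spaces `M* ⊗_𝕜 M` over all finite-dimensional differential
`K`-vector spaces `M`. -/
abbrev PreDual : Type (u + 1) :=
  DirectSum (FinDiffMod K) fun M => Module.Dual K M ⊗[Constants K] M

instance : AddCommGroup (PreDual K) :=
  @DirectSum.instAddCommGroup _ (fun M : FinDiffMod K => Module.Dual K M ⊗[Constants K] M)
    fun _ => TensorProduct.addCommGroup

/-- The element `φ ⊗ m` of the summand of `M`. -/
def preCls (M : FinDiffMod K) (φ : Module.Dual K M) (m : M) : PreDual K :=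
  DirectSum.lof (Constants K) (FinDiffMod K) (fun M => Module.Dual K M ⊗[Constants K] M) M
    (φ ⊗ₜ[Constants K] m)

variable (K) in
/-- The span of all `ψ ⊗ f x - ψ f ⊗ x` with `f : M → N` a morphism, `ψ ∈ N*`, `x ∈ M`. The case
`M = N` gives the relations that turn `M* ⊗_𝕜 M` into `M* ⊗_{T_M} M`, where `T_M` is the
algebra of endomorphisms of `M`. -/
def relations : Submodule (Constants K) (PreDual K) :=
  Submodule.span (Constants K)
    {z | ∃ (M N : FinDiffMod K) (f : FinDiffMod.Hom M N) (ψ : Module.Dual K N) (x : M),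
      z = preCls N ψ (f.toLin x) - preCls M (ψ ∘ₗ f.toLin) x}

variable (K) in
/-- The finite dual `U°`: the quotient of `⨁_M M* ⊗_{T_M} M` by the relations
`ψ ⊗ f x = ψ f ⊗ x`. -/
def FiniteDual : Type (u + 1) := PreDual K ⧸ relations K

namespace FiniteDual

instance : AddCommGroup (FiniteDual K) := inferInstanceAs (AddCommGroup (PreDual K ⧸ relations K))

instance : Module (Constants K) (FiniteDual K) :=
  inferInstanceAs (Module (Constants K) (PreDual K ⧸ relations K))

variable (K) in
/-- The quotient map. -/
def mk : PreDual K →ₗ[Constants K] FiniteDual K := (relations K).mkQ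

/-- The class of `φ ⊗ m`, for `φ ∈ M*` and `m ∈ M`. -/
def cls (M : FinDiffMod K) (φ : Module.Dual K M) (m : M) : FiniteDual K := mk K (preCls M φ m)

lemma cls_hom {M N : FinDiffMod K} (f : FinDiffMod.Hom M N) (ψ : Module.Dual K N) (x : M) :
    cls N ψ (f.toLin x) = cls M (ψ ∘ₗ f.toLin) x := by
  rw [← sub_eq_zero, cls, cls, ← map_sub]
  exact (Submodule.Quotient.mk_eq_zero _).2 (Submodule.subset_span ⟨M, N, f, ψ, x, rfl⟩)

lemma cls_add (M : FinDiffMod K) (φ : Module.Dual K M) (m n : M) :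
    cls M φ (m + n) = cls M φ m + cls M φ n := by
  simp only [cls, preCls, TensorProduct.tmul_add, map_add]

lemma add_cls (M : FinDiffMod K) (φ ψ : Module.Dual K M) (m : M) :
    cls M (φ + ψ) m = cls M φ m + cls M ψ m := by
  simp only [cls, preCls, TensorProduct.add_tmul, map_add]

lemma cls_smul (M : FinDiffMod K) (φ : Module.Dual K M) (c : Constants K) (m : M) :
    cls M φ (c • m) = c • cls M φ m := by
  simp only [cls, preCls, TensorProduct.tmul_smul, map_smul]

lemma smul_cls (M : FinDiffMod K) (φ : Module.Dual K M) (c : Constants K) (m : M) :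
    cls M (c • φ) m = c • cls M φ m := by
  rw [cls, preCls, ← TensorProduct.smul_tmul', map_smul, map_smul]; rfl

@[elab_as_elim]
lemma induction_on {P : FiniteDual K → Prop} (z : FiniteDual K)
    (zero : P 0) (add : ∀ a b, P a → P b → P (a + b)) (cls : ∀ M φ m, P (cls M φ m)) : P z := by
  obtain ⟨w, rfl⟩ := Submodule.mkQ_surjective (relations K) z
  change P (mk K w)
  induction w using DirectSum.induction_on with
  | zero => rw [map_zero]; exact zero
  | add a b ha hb => rw [map_add]; exact add _ _ ha hb
  | of M t =>
    induction t using TensorProduct.induction_on with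
    | zero => rw [map_zero, map_zero]; exact zero
    | add a b ha hb => rw [map_add, map_add]; exact add _ _ ha hb
    | tmul φ m => exact cls M φ m

/-- The linear map out of `⨁_M M* ⊗_𝕜 M` given by a family of bilinear maps. -/
def preLift {E : Type*} [AddCommGroup E] [Module (Constants K) E]
    (F : ∀ M : FinDiffMod K, Module.Dual K M →ₗ[Constants K] M →ₗ[Constants K] E) :
    PreDual K →ₗ[Constants K] E :=
  DirectSum.toModule (Constants K) (FinDiffMod K) E fun M => TensorProduct.lift (F M)

@[simp] lemma preLift_preCls {E : Type*} [AddCommGroup E] [Module (Constants K) E]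
    (F : ∀ M : FinDiffMod K, Module.Dual K M →ₗ[Constants K] M →ₗ[Constants K] E)
    (M : FinDiffMod K) (φ : Module.Dual K M) (m : M) :
    preLift F (preCls M φ m) = F M φ m := by
  rw [preLift, preCls, DirectSum.toModule_lof, TensorProduct.lift.tmul]

/-- The linear map out of `U°` given by a compatible family of bilinear maps. -/
def lift {E : Type*} [AddCommGroup E] [Module (Constants K) E]
    (F : ∀ M : FinDiffMod K, Module.Dual K M →ₗ[Constants K] M →ₗ[Constants K] E)
    (h : ∀ (M N : FinDiffMod K) (f : FinDiffMod.Hom M N) (ψ : Module.Dual K N) (x : M),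
      F N ψ (f.toLin x) = F M (ψ ∘ₗ f.toLin) x) :
    FiniteDual K →ₗ[Constants K] E :=
  (relations K).liftQ (preLift F) (by
    refine Submodule.span_le.2 ?_
    rintro _ ⟨M, N, f, ψ, x, rfl⟩
    rw [SetLike.mem_coe, LinearMap.mem_ker, map_sub, preLift_preCls, preLift_preCls, h, sub_self])

@[simp] lemma lift_cls {E : Type*} [AddCommGroup E] [Module (Constants K) E]
    (F : ∀ M : FinDiffMod K, Module.Dual K M →ₗ[Constants K] M →ₗ[Constants K] E)
    (h : ∀ (M N : FinDiffMod K) (f : FinDiffMod.Hom M N) (ψ : Module.Dual K N) (x : M),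
      F N ψ (f.toLin x) = F M (ψ ∘ₗ f.toLin) x)
    (M : FinDiffMod K) (φ : Module.Dual K M) (m : M) : lift F h (cls M φ m) = F M φ m :=
  preLift_preCls F M φ m

/-! #### The multiplication -/

open FinDiffMod

lemma diamond_add {M N : FinDiffMod K} (ψ : Module.Dual K N) (φ φ' : Module.Dual K M) :
    diamond ψ (φ + φ') = diamond ψ φ + diamond ψ φ' :=
  dual_ext fun q p => by simp only [diamond_tmul, LinearMap.add_apply, mul_add]

lemma add_diamond {M N : FinDiffMod K} (ψ ψ' : Module.Dual K N) (φ : Module.Dual K M) :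
    diamond (ψ + ψ') φ = diamond ψ φ + diamond ψ' φ :=
  dual_ext fun q p => by simp only [diamond_tmul, LinearMap.add_apply, add_mul]

lemma diamond_smul {M N : FinDiffMod K} (ψ : Module.Dual K N) (c : Constants K)
    (φ : Module.Dual K M) : diamond ψ (c • φ) = c • diamond ψ φ :=
  dual_ext fun q p => by
    simp only [diamond_tmul, LinearMap.smul_apply, Algebra.smul_def]; ring

lemma smul_diamond {M N : FinDiffMod K} (ψ : Module.Dual K N) (c : Constants K)
    (φ : Module.Dual K M) : diamond (c • ψ) φ = c • diamond ψ φ :=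
  dual_ext fun q p => by
    simp only [diamond_tmul, LinearMap.smul_apply, Algebra.smul_def]; ring

lemma tmul_add {M N : FinDiffMod K} (q : N) (p p' : M) :
    tmul q (p + p') = tmul q p + tmul q p' := TensorProduct.tmul_add q p p'

lemma add_tmul {M N : FinDiffMod K} (q q' : N) (p : M) :
    tmul (q + q') p = tmul q p + tmul q' p := TensorProduct.add_tmul q q' p

lemma tmul_smul {M N : FinDiffMod K} (q : N) (c : Constants K) (p : M) :
    tmul q (c • p) = c • tmul q p :=
  TensorProduct.tmul_smul (R := K) (algebraMap (Constants K) K c) q p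

lemma smul_tmul {M N : FinDiffMod K} (q : N) (c : Constants K) (p : M) :
    tmul (c • q) p = c • tmul q p := by
  exact (TensorProduct.smul_tmul' (R := K) (algebraMap (Constants K) K c) q p).symm

/-- `w ↦ (φ ⊗ p) · w`. -/
def mulLeft (M : FinDiffMod K) (φ : Module.Dual K M) (p : M) :
    FiniteDual K →ₗ[Constants K] FiniteDual K :=
  lift
    (fun N => LinearMap.mk₂ (Constants K)
      (fun (ψ : Module.Dual K N) (q : N) => cls (N.tensor M) (diamond ψ φ) (tmul q p))
      (fun ψ ψ' q => by rw [add_diamond, add_cls])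
      (fun c ψ q => by rw [smul_diamond, smul_cls])
      (fun ψ q q' => by rw [add_tmul, cls_add])
      (fun c ψ q => by rw [smul_tmul, cls_smul]))
    (fun N N' f ψ x => by
      rw [LinearMap.mk₂_apply, LinearMap.mk₂_apply]
      refine (cls_hom (f.tensor (Hom.id M)) (diamond ψ φ) (tmul x p)).trans ?_
      congr 1
      refine dual_ext fun a b => ?_
      rw [diamond_tmul]
      exact diamond_tmul ψ φ (f.toLin a) b)

lemma mulLeft_cls (M : FinDiffMod K) (φ : Module.Dual K M) (p : M)
    (N : FinDiffMod K) (ψ : Module.Dual K N) (q : N) :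
    mulLeft M φ p (cls N ψ q) = cls (N.tensor M) (diamond ψ φ) (tmul q p) := by
  rw [mulLeft, lift_cls, LinearMap.mk₂_apply]

lemma hom_ext {E : Type*} [AddCommGroup E] [Module (Constants K) E]
    {F G : FiniteDual K →ₗ[Constants K] E} (h : ∀ M φ m, F (cls M φ m) = G (cls M φ m)) :
    F = G := by
  ext z
  induction z using induction_on with
  | zero => simp
  | add a b ha hb => simp [ha, hb]
  | cls M φ m => exact h M φ m

variable (K) in
/-- The multiplication of `U°` as a bilinear map. -/
def mulHom : FiniteDual K →ₗ[Constants K] FiniteDual K →ₗ[Constants K] FiniteDual K :=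
  lift
    (fun M => LinearMap.mk₂ (Constants K) (fun (φ : Module.Dual K M) (p : M) => mulLeft M φ p)
      (fun φ φ' p => hom_ext fun N ψ q => by
        rw [LinearMap.add_apply, mulLeft_cls, mulLeft_cls, mulLeft_cls, diamond_add, add_cls])
      (fun c φ p => hom_ext fun N ψ q => by
        rw [LinearMap.smul_apply, mulLeft_cls, mulLeft_cls, diamond_smul, smul_cls])
      (fun φ p p' => hom_ext fun N ψ q => by
        rw [LinearMap.add_apply, mulLeft_cls, mulLeft_cls, mulLeft_cls, tmul_add, cls_add])
      (fun c φ p => hom_ext fun N ψ q => by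
        rw [LinearMap.smul_apply, mulLeft_cls, mulLeft_cls, tmul_smul, cls_smul]))
    (fun M M' f φ x => hom_ext fun N ψ q => by
      rw [LinearMap.mk₂_apply, LinearMap.mk₂_apply, mulLeft_cls, mulLeft_cls]
      refine (cls_hom ((Hom.id N).tensor f) (diamond ψ φ) (tmul q x)).trans ?_
      congr 1
      refine dual_ext fun a b => ?_
      rw [diamond_tmul]
      exact diamond_tmul ψ φ a (f.toLin b))

/-- The multiplication of `U°`: `(φ ⊗ p) · (ψ ⊗ q) = (ψ ◇ φ) ⊗ (q ⊗ p)`. -/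
instance : Mul (FiniteDual K) := ⟨fun a b => mulHom K a b⟩

lemma mul_def (a b : FiniteDual K) : a * b = mulHom K a b := rfl

lemma cls_mul_cls (M N : FinDiffMod K) (φ : Module.Dual K M) (p : M) (ψ : Module.Dual K N)
    (q : N) : cls M φ p * cls N ψ q = cls (N.tensor M) (diamond ψ φ) (tmul q p) := by
  rw [mul_def, mulHom, lift_cls, LinearMap.mk₂_apply, mulLeft_cls]

/-- The unit of `U°`: the class of `id ⊗ 1` in `K* ⊗ K`, from the unit object `K`. -/
instance : One (FiniteDual K) := ⟨cls (unit K) (scal K 1) (ofK K 1)⟩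

lemma one_def : (1 : FiniteDual K) = cls (unit K) (scal K 1) (ofK K 1) := rfl

lemma add_mul'' (a b c : FiniteDual K) : (a + b) * c = a * c + b * c := by
  simp only [mul_def, map_add, LinearMap.add_apply]

lemma mul_add'' (a b c : FiniteDual K) : a * (b + c) = a * b + a * c := by
  simp only [mul_def, map_add]

lemma zero_mul'' (a : FiniteDual K) : 0 * a = 0 := by
  simp only [mul_def, map_zero, LinearMap.zero_apply]

lemma mul_zero'' (a : FiniteDual K) : a * 0 = 0 := by
  simp only [mul_def, map_zero]

lemma mul_comm'' (a b : FiniteDual K) : a * b = b * a := by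
  induction a using induction_on with
  | zero => rw [zero_mul'', mul_zero'']
  | add a a' ha ha' => rw [add_mul'', mul_add'', ha, ha']
  | cls M φ p =>
    induction b using induction_on with
    | zero => rw [zero_mul'', mul_zero'']
    | add b b' hb hb' => rw [add_mul'', mul_add'', hb, hb']
    | cls N ψ q =>
      rw [cls_mul_cls, cls_mul_cls]
      refine Eq.trans ?_ (cls_hom (Hom.swap N M) (diamond φ ψ) (tmul q p)).symm
      congr 1
      refine dual_ext fun x y => ?_
      rw [diamond_tmul, mul_comm]
      exact (diamond_tmul φ ψ y x).symm

lemma one_mul'' (a : FiniteDual K) : 1 * a = a := by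
  rw [mul_comm'']
  induction a using induction_on with
  | zero => rw [zero_mul'']
  | add a a' ha ha' => rw [add_mul'', ha, ha']
  | cls M φ p =>
    rw [one_def, cls_mul_cls]
    have h := cls_hom (Hom.lid M) φ (tmul (ofK K 1) p)
    have h1 : (Hom.lid M).toLin (tmul (ofK K 1) p) = p := one_smul K p
    rw [h1] at h
    rw [h]
    congr 1
    refine dual_ext fun x y => ?_
    rw [diamond_tmul]
    have h2 : ∀ x : K, (1 * x) * φ y = φ (x • y) := fun x => by
      rw [one_mul, map_smul, smul_eq_mul]
    exact h2 x

lemma mul_assoc'' (a b c : FiniteDual K) : a * b * c = a * (b * c) := by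
  induction a using induction_on with
  | zero => simp only [zero_mul'']
  | add a a' ha ha' => simp only [add_mul'', ha, ha']
  | cls M φ p =>
    induction b using induction_on with
    | zero => simp only [zero_mul'', mul_zero'']
    | add b b' hb hb' => simp only [add_mul'', mul_add'', hb, hb']
    | cls N ψ q =>
      induction c using induction_on with
      | zero => simp only [mul_zero'']
      | add c c' hc hc' => simp only [mul_add'', hc, hc']
      | cls P χ r =>
        rw [cls_mul_cls, cls_mul_cls, cls_mul_cls, cls_mul_cls]
        refine (cls_hom (Hom.assoc P N M) (diamond χ (diamond ψ φ)) (tmul (tmul r q) p)).trans ?_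
        congr 1
        refine TensorProduct.ext_threefold (M := P) (N := N) (P := M) fun x y z => ?_
        refine (diamond_tmul χ (diamond ψ φ) x (tmul y z)).trans ?_
        refine Eq.trans ?_ (diamond_tmul (diamond χ ψ) φ (tmul x y) z).symm
        rw [diamond_tmul, diamond_tmul, mul_assoc]

instance : CommRing (FiniteDual K) :=
  { (inferInstance : AddCommGroup (FiniteDual K)),
    (inferInstance : Mul (FiniteDual K)), (inferInstance : One (FiniteDual K)) with
    mul_comm := mul_comm''
    left_distrib := mul_add''
    right_distrib := add_mul''
    zero_mul := zero_mul''
    mul_zero := mul_zero''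
    one_mul := one_mul''
    mul_one := fun a => (mul_comm'' a 1).trans (one_mul'' a)
    mul_assoc := mul_assoc'' }

/-- `U°` is an algebra over the constants. -/
instance : Algebra (Constants K) (FiniteDual K) :=
  Algebra.ofModule
    (fun c a b => by rw [mul_def, map_smul]; rfl)
    (fun c a b => map_smul (mulHom K a) c b)

lemma unit_mul_unit (φ ψ p q : K) :
    cls (unit K) (scal K φ) (ofK K p) * cls (unit K) (scal K ψ) (ofK K q) =
    cls (unit K) (scal K (φ * ψ)) (ofK K (p * q)) := by
  rw [cls_mul_cls, mul_comm p q]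
  refine Eq.trans ?_ (cls_hom (Hom.lid (unit K)) (scal K (φ * ψ))
    (tmul (ofK K q) (ofK K p))).symm
  congr 1
  refine dual_ext fun x y => ?_
  rw [diamond_tmul]
  have h : ∀ x y : K, (ψ * x) * (φ * y) = (φ * ψ) * (x * y) := fun x y => by ring
  exact h x y

variable (K) in
/-- The source `s : K → U°`, `x ↦ x ⊗ 1`, from the unit object `K`. -/
def source : K →ₐ[Constants K] FiniteDual K :=
  AlgHom.ofLinearMap
    { toFun := fun x => cls (unit K) (scal K x) (ofK K 1)
      map_add' := fun x y => by rw [← add_cls, scal, add_smul]; rfl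
      map_smul' := fun c x => by
        rw [RingHom.id_apply, ← smul_cls]
        congr 1
        exact smul_assoc c x (LinearMap.id : K →ₗ[K] K) }
    rfl (fun x y => by
      change cls _ _ _ = cls _ _ _ * cls _ _ _
      rw [unit_mul_unit, one_mul])

variable (K) in
/-- The target `t : K → U°`, `x ↦ 1 ⊗ x`, from the unit object `K`. -/
def target : K →ₐ[Constants K] FiniteDual K :=
  AlgHom.ofLinearMap
    { toFun := fun x => cls (unit K) (scal K 1) (ofK K x)
      map_add' := fun x y => cls_add (unit K) (scal K 1) (ofK K x) (ofK K y)
      map_smul' := fun c x => by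
        rw [RingHom.id_apply, ← cls_smul]
        exact congrArg (cls (unit K) (scal K 1)) (Algebra.smul_def c x) }
    rfl (fun x y => by
      change cls _ _ _ = cls _ _ _ * cls _ _ _
      rw [unit_mul_unit, one_mul])

/-- `U°` as a `(K ⊗ K)`-algebra: `x ⊗ y ↦ s(x) t(y)`. -/
instance : Algebra (K ⊗[Constants K] K) (FiniteDual K) :=
  (Algebra.TensorProduct.productMap (source K) (target K)).toRingHom.toAlgebra

end FiniteDual

/-! ### `U*` as a `(K ⊗ K)`-algebra -/

namespace UDual

lemma comul_basis (n : ℕ) : Coalgebra.comul (R := K) (OreExt.basis K n) =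
    ∑ k ∈ Finset.range (n + 1), n.choose k • (OreExt.basis K k ⊗ₜ[K] OreExt.basis K (n - k)) :=
  (OreExt.basis K).constr_basis K _ n

lemma counit_basis (n : ℕ) : Coalgebra.counit (R := K) (OreExt.basis K n) =
    if n = 0 then 1 else 0 :=
  (OreExt.basis K).constr_basis K _ n

lemma mul_basis (f g : UDual K) (n : ℕ) : (f * g) (OreExt.basis K n) =
    ∑ k ∈ Finset.range (n + 1),
      n.choose k • (f (OreExt.basis K k) * g (OreExt.basis K (n - k))) := by
  simp only [LinearMap.convMul_apply, comul_basis, map_sum, map_nsmul, TensorProduct.map_tmul,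
    LinearMap.mul'_apply]

lemma iter_mul (n : ℕ) (x y : K) : (fun z : K => z′)^[n] (x * y) =
    ∑ k ∈ Finset.range (n + 1), n.choose k •
      ((fun z : K => z′)^[k] x * (fun z : K => z′)^[n - k] y) := by
  rw [← Finset.Nat.sum_antidiagonal_eq_sum_range_succ
    (fun i j => n.choose i • ((fun z : K => z′)^[i] x * (fun z : K => z′)^[j] y))]
  induction n with
  | zero => simp
  | succ n ih =>
    rw [Finset.sum_antidiagonal_choose_succ_nsmul
      (fun i j => (fun z : K => z′)^[i] x * (fun z : K => z′)^[j] y), Function.iterate_succ_apply',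
      ih, ← Finset.sum_add_distrib, map_sum]
    refine Finset.sum_congr rfl fun p hp => ?_
    rw [map_nsmul, Derivation.leibniz, Function.iterate_succ_apply', Function.iterate_succ_apply',
      smul_eq_mul, smul_eq_mul,
      ← Nat.choose_symm_of_eq_add (Finset.HasAntidiagonal.mem_antidiagonal.1 hp).symm, ← smul_add]
    congr 2
    ring

lemma ext_basis {f g : UDual K} (h : ∀ n, f (OreExt.basis K n) = g (OreExt.basis K n)) :
    f = g :=
  WithConv.ext ((OreExt.basis K).ext h)

/-- The functional `u ↦ x ◁ u` for the action of `U` on `K` with `x ◁ Y = ∂ x`; it is the right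
`K`-linear map with `Yⁿ ↦ ∂ⁿ x`. -/
def actK (x : K) : UDual K :=
  WithConv.toConv ((OreExt.basis K).constr K fun n => (fun z : K => z′)^[n] x)

lemma actK_basis (x : K) (n : ℕ) : actK x (OreExt.basis K n) = (fun z : K => z′)^[n] x :=
  (OreExt.basis K).constr_basis K _ n

variable (K) in
/-- `μ : K → U*`, `μ(x)(u) = x ◁ u`, for the action of `U` on `K` with `x ◁ Y = ∂ x`. -/
def μ : K →ₐ[Constants K] UDual K :=
  AlgHom.ofLinearMap
    { toFun := actK
      map_add' := fun x y => ext_basis fun n => by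
        simp only [WithConv.ofConv_add, LinearMap.add_apply, actK_basis, OreExt.iter_add]
      map_smul' := fun c x => ext_basis fun n => by
        simp only [WithConv.ofConv_smul, LinearMap.smul_apply, actK_basis, RingHom.id_apply]
        exact (FinDiffMod.unit K).iter_const_smul n c (FinDiffMod.ofK K x) }
    (ext_basis fun n => by
      change actK 1 _ = _
      rw [actK_basis, LinearMap.convOne_apply, counit_basis]
      cases n with
      | zero => simp
      | succ n => simp [Function.iterate_succ_apply])
    (fun x y => ext_basis fun n => by
      change actK (x * y) _ = (actK x * actK y) _
      simp only [mul_basis, actK_basis, iter_mul])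

instance : IsScalarTower (Constants K) K (UDual K) where
  smul_assoc c x f := WithConv.ext (LinearMap.ext fun u => smul_assoc c x (f u))

/-- `U*` as a `(K ⊗ K)`-algebra: `x ⊗ 1 ↦ x ε` and `1 ⊗ x ↦ μ(x)`. -/
instance : Algebra (K ⊗[Constants K] K) (UDual K) :=
  (Algebra.TensorProduct.productMap
    ((Algebra.ofId K (UDual K)).restrictScalars (Constants K)) (μ K)).toRingHom.toAlgebra

end UDual

/-! ### The canonical map `ζ` and the functionals that vanish on right ideals -/

variable (K) in
/-- The canonical map `ζ : U° → U*`, `ζ(φ ⊗ m)(u) = φ(m ◁ u)`. -/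
def ζ : FiniteDual K →ₗ[Constants K] UDual K :=
  FiniteDual.lift
    (fun M => LinearMap.mk₂ (Constants K)
      (fun (φ : Module.Dual K M) (m : M) => WithConv.toConv (φ ∘ₗ M.act m))
      (fun φ φ' m => by rw [LinearMap.add_comp, WithConv.toConv_add])
      (fun c φ m => by rw [LinearMap.smul_comp, WithConv.toConv_smul])
      (fun φ m m' => by rw [FinDiffMod.act_add, LinearMap.comp_add, WithConv.toConv_add])
      (fun c φ m => UDual.ext_basis fun n => by
        simp only [WithConv.ofConv_smul, LinearMap.smul_apply, LinearMap.comp_apply,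
          FinDiffMod.act_basis, FinDiffMod.iter_const_smul]
        exact LinearMap.map_smul_of_tower φ c _))
    (fun M N f ψ x => UDual.ext_basis fun n => by
      simp only [LinearMap.mk₂_apply, LinearMap.comp_apply, FinDiffMod.act_basis, f.iter_comm])

lemma ζ_cls (M : FinDiffMod K) (φ : Module.Dual K M) (m : M) (u : OreExt K) :
    ζ K (FiniteDual.cls M φ m) u = φ (M.act m u) := by
  rw [ζ, FiniteDual.lift_cls, LinearMap.mk₂_apply]; rfl

/-- The right ideal `J` of `U`, as a right `K`-subspace, has finite codimension. (A right ideal is a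
submodule of `U` over `Uᵐᵒᵖ`; it is principal if it is `P U` for some `P`.) -/
def FiniteCodim (J : Submodule (OreExt K)ᵐᵒᵖ (OreExt K)) : Prop :=
  FiniteDimensional K (OreExt K ⧸ J.restrictScalars K)

end

end DiffOps

/-! The subalgebra `S` is the range of `ζ`. It therefore suffices that `ζ` is an injective
homomorphism of `(K ⊗ K)`-algebras and that its range is described by either vanishing condition;
closure of the vanishing functionals under sums and products never has to be checked directly.

Since differential spaces have direct sums, every element of `U°` is the class of one pure tensor `φ
⊗ m` (`exists_cls`). Along the inclusion of `m ◁ U` into `M`, this class equals that of `φ|_{m ◁ U}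
⊗ m`. If `ζ` sends it to zero, then `φ` vanishes at every `m ◁ u`, so the restricted functional is
zero and so is the class (`ζ_injective`). Multiplicativity (`ζ_mul`) is the iterated Leibniz rule on
`N ⊗ M`, whose binomial coefficients are those of the comultiplication.

The functional `u ↦ φ(m ◁ u)` vanishes on the annihilator of `m`, and `U / Ann(m) ≅ m ◁ U` is
finite-dimensional (`ζ_vanishes`). Conversely, for a right ideal `J` of finite codimension, `U / J`
is a differential space under right multiplication by `Y`. A functional that kills `J` factors as
some `φ` on `U / J`, and it is the image of `φ ⊗ 1` (`exists_ζ_eq`).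

Principal ideals suffice because `U` is infinite-dimensional: `J` contains some `P ≠ 0`, and
division by the leading term of `P` shows that `P U` already has finite codimension
(`finiteCodim_of_mem`). -/

namespace DiffOps

universe u

open scoped Differential
open FinDiffMod FiniteDual

variable {K : Type u} [Field K] [Differential K]

noncomputable section

/-! ### Differential spaces: direct sums, cyclic subspaces, iterated Leibniz rule, annihilators -/

namespace FinDiffMod

/-- The direct sum of two differential spaces. -/
def prod (M N : FinDiffMod K) : FinDiffMod K where
  carrier := M × N
  der := M.der.prodMap N.der
  leibniz x m := Prod.ext (M.leibniz x m.1) (N.leibniz x m.2)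

/-- The first projection. -/
def Hom.fst (M N : FinDiffMod K) : Hom (M.prod N) M := ⟨LinearMap.fst K M N, fun _ => rfl⟩

/-- The second projection. -/
def Hom.snd (M N : FinDiffMod K) : Hom (M.prod N) N := ⟨LinearMap.snd K M N, fun _ => rfl⟩

/-- The differential subspace `m ◁ U` generated by `m`. -/
def cyclic (M : FinDiffMod K) (m : M) : FinDiffMod K where
  carrier := LinearMap.range (M.act m)
  der := (M.der.comp (LinearMap.range (M.act m)).subtype.toAddMonoidHom).codRestrict
    (LinearMap.range (M.act m)) (by
      rintro ⟨_, u, rfl⟩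
      exact ⟨u * OreExt.Y, M.act_mul_Y m u⟩)
  leibniz x a := Subtype.ext (M.leibniz x a)

/-- The inclusion of `m ◁ U` into `M`. -/
def cyclicHom (M : FinDiffMod K) (m : M) : Hom (M.cyclic m) M :=
  ⟨(LinearMap.range (M.act m)).subtype, fun _ => rfl⟩

lemma act_one (M : FinDiffMod K) (m : M) : M.act m 1 = m := by
  rw [← pow_zero OreExt.Y, act_pow]; rfl

/-- The generator of `m ◁ U`. -/
def cyclicGen (M : FinDiffMod K) (m : M) : M.cyclic m :=
  (⟨m, 1, M.act_one m⟩ : LinearMap.range (M.act m))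

/-- The iterated Leibniz rule on a tensor product. -/
lemma iter_tmul {M N : FinDiffMod K} (q : M) (p : N) (n : ℕ) :
    (M.tensor N).der^[n] (tmul q p) =
      ∑ k ∈ Finset.range (n + 1), n.choose k • tmul (M.der^[k] q) (N.der^[n - k] p) := by
  rw [← Finset.Nat.sum_antidiagonal_eq_sum_range_succ
    (fun i j => n.choose i • tmul (M.der^[i] q) (N.der^[j] p))]
  induction n with
  | zero => simp
  | succ n ih =>
    rw [Finset.sum_antidiagonal_choose_succ_nsmul
      (fun i j => tmul (M.der^[i] q) (N.der^[j] p)), Function.iterate_succ_apply',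
      ih, ← Finset.sum_add_distrib, map_sum]
    -- Pascal's rule has split the sum for `n + 1` in two, the second part with coefficient
    -- `n.choose j`. The symmetry `n.choose i = n.choose j` for `i + j = n` makes the coefficients
    -- agree, leaving one application of the Leibniz rule to each term.
    refine Finset.sum_congr rfl fun p hp => ?_
    rw [map_nsmul, Function.iterate_succ_apply', Function.iterate_succ_apply',
      ← Nat.choose_symm_of_eq_add (Finset.HasAntidiagonal.mem_antidiagonal.1 hp).symm, ← smul_add,
      add_comm]
    rfl

/-- The annihilator of `m`, a right ideal of `U`. -/
def annihilator (M : FinDiffMod K) (m : M) : Submodule (OreExt K)ᵐᵒᵖ (OreExt K) where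
  carrier := {u | M.act m u = 0}
  zero_mem' := map_zero _
  add_mem' {a b} ha hb := by
    change M.act m (a + b) = 0
    rw [map_add, ha, hb, add_zero]
  smul_mem' v u hu := by
    change M.act m (u * v.unop) = 0
    have h0 : M.act m u = 0 := hu
    -- Additivity in the vector gives `act 0 = act 0 + act 0`, hence `act 0 = 0`.
    have h := M.act_add 0 0
    rw [add_zero] at h
    rw [← act_act, h0, left_eq_add.1 h, LinearMap.zero_apply]

/-- The annihilator is the kernel of the `K`-linear map `u ↦ m ◁ u`, so the quotient is isomorphic
to a subspace of the finite-dimensional `M`. -/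
lemma finiteCodim_annihilator (M : FinDiffMod K) (m : M) : FiniteCodim (M.annihilator m) := by
  have h : (M.annihilator m).restrictScalars K = LinearMap.ker (M.act m) := rfl
  rw [FiniteCodim, h]
  exact Module.Finite.equiv (M.act m).quotKerEquivRange.symm

end FinDiffMod

/-! ### Right ideals of `U` and their quotients -/

namespace OreExt

lemma mul_mem {J : Submodule (OreExt K)ᵐᵒᵖ (OreExt K)} {u : OreExt K} (hu : u ∈ J)
    (v : OreExt K) : u * v ∈ J := J.smul_mem (MulOpposite.op v) hu

lemma smul_mul_Y (c : K) (u : OreExt K) : (c • u) * Y = c • (u * Y) + c′ • u := by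
  rw [smul_eq, mul_assoc, of_mul_Y, mul_add, ← mul_assoc, ← smul_eq, ← smul_eq]

/-- A nonzero element has, up to a scalar, the form `Yⁿ + (terms of degree < n)`. -/
lemma exists_basis_add_mem_span {P : OreExt K} (hP : P ≠ 0) :
    ∃ (n : ℕ) (c : K), basis K n - c • P ∈ Submodule.span K (basis K '' Set.Iio n) := by
  let p : Polynomial K := P
  have hp : p.leadingCoeff ≠ 0 := Polynomial.leadingCoeff_ne_zero.2 hP
  -- `U` and the commutative polynomials share the same coefficient sequences, so degree and leading
  -- coefficient can be read off there. Scaling by the inverse leading coefficient cancels the top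
  -- term.
  refine ⟨p.natDegree, p.leadingCoeff⁻¹, ?_⟩
  have h1 : (basis K p.natDegree : OreExt K) - p.leadingCoeff⁻¹ • P =
      ∑ i ∈ Finset.range p.natDegree, (-(p.leadingCoeff⁻¹ * p.coeff i)) • basis K i := by
    have h2 : P = ∑ i ∈ Finset.range (p.natDegree + 1), p.coeff i • basis K i := by
      have h3 := p.as_sum_range
      have h4 : ∀ i, Polynomial.monomial i (p.coeff i) =
          p.coeff i • (Polynomial.monomial i 1 : Polynomial K) := fun i => by
        rw [Polynomial.smul_monomial, smul_eq_mul, mul_one]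
      simp only [h4] at h3
      refine h3.trans (Finset.sum_congr rfl fun i _ => ?_)
      exact congrArg (p.coeff i • ·) (congrFun (Polynomial.coe_basisMonomials (R := K)) i).symm
    rw [h2, Finset.sum_range_succ, smul_add, smul_smul, Polynomial.coeff_natDegree,
      inv_mul_cancel₀ hp, one_smul, Finset.smul_sum]
    simp only [neg_smul, Finset.sum_neg_distrib, smul_smul]
    abel
  rw [h1]
  exact Submodule.sum_mem _ fun i hi => Submodule.smul_mem _ _
    (Submodule.subset_span ⟨i, Finset.mem_range.1 hi, rfl⟩)

/-- A nonzero right ideal of `U` has finite codimension. -/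
lemma finiteCodim_of_mem {J : Submodule (OreExt K)ᵐᵒᵖ (OreExt K)} {P : OreExt K} (hP : P ≠ 0)
    (hJ : P ∈ J) : FiniteCodim J := by
  obtain ⟨n, c, hn⟩ := exists_basis_add_mem_span hP
  let W := Submodule.span K (basis K '' Set.Iio n)
  -- The aim is `V = U`: `V` contains `1` and is stable under right multiplication by `Y`. The only
  -- critical case of stability is `Yⁿ⁻¹ Y = Yⁿ`, which lies in `V` because `P` expresses `Yⁿ`
  -- through lower powers modulo `J`.
  let V := W ⊔ J.restrictScalars K
  have hW : W ≤ V := le_sup_left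
  have hJV : J.restrictScalars K ≤ V := le_sup_right
  have hnV : basis K n ∈ V := by
    have h := V.add_mem (hW hn) (V.smul_mem c (hJV hJ))
    rwa [sub_add_cancel] at h
  have hbasis : ∀ i ≤ n, basis K i ∈ V := fun i hi => by
    rcases hi.lt_or_eq with h | rfl
    · exact hW (Submodule.subset_span ⟨i, h, rfl⟩)
    · exact hnV
  have hY : ∀ u ∈ V, u * Y ∈ V := by
    intro u hu
    obtain ⟨w, hw, j, hj, rfl⟩ := Submodule.mem_sup.1 hu
    rw [add_mul]
    refine V.add_mem ?_ (hJV (mul_mem hj Y))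
    -- The hypothesis that `w + j` lies in `V` travels along with this induction, so each inductive
    -- hypothesis has to be supplied with such a proof.
    induction hw using Submodule.span_induction with
    | mem x hx =>
      obtain ⟨i, hi, rfl⟩ := hx
      rw [basis_eq, ← pow_succ, ← basis_eq]
      exact hbasis (i + 1) hi
    | zero => rw [zero_mul]; exact V.zero_mem
    | add x y hx hy h1 h2 =>
      rw [add_mul]
      exact V.add_mem (h1 (V.add_mem (hW hx) (hJV hj))) (h2 (V.add_mem (hW hy) (hJV hj)))
    | smul a x hx h =>
      rw [smul_mul_Y]
      exact V.add_mem (V.smul_mem _ (h (V.add_mem (hW hx) (hJV hj)))) (V.smul_mem _ (hW hx))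
  have hV : V = ⊤ := by
    rw [eq_top_iff, ← (basis K).span_eq, Submodule.span_le]
    rintro _ ⟨i, rfl⟩
    induction i with
    | zero => exact hbasis 0 n.zero_le
    | succ i ih =>
      have h := hY _ ih
      rw [basis_eq, ← pow_succ, ← basis_eq] at h
      exact h
  have hfin : FiniteDimensional K W :=
    FiniteDimensional.span_of_finite K ((Set.finite_Iio n).image _)
  -- As `W + J = U`, the finite-dimensional `W` maps onto `U / J`.
  refine Module.Finite.of_surjective ((J.restrictScalars K).mkQ ∘ₗ W.subtype) ?_
  rw [← LinearMap.range_eq_top, LinearMap.range_comp, Submodule.range_subtype,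
    Submodule.map_mkQ_eq_top, sup_comm]
  exact hV

/-- Otherwise `J = 0` and `U` itself would be finite-dimensional, although the powers of `Y` form an
infinite basis. -/
lemma exists_ne_zero_of_finiteCodim {J : Submodule (OreExt K)ᵐᵒᵖ (OreExt K)}
    (hJ : FiniteCodim J) : ∃ P ∈ J, P ≠ 0 := by
  by_contra! h
  have h0 : J.restrictScalars K = ⊥ := (Submodule.eq_bot_iff _).2 h
  rw [FiniteCodim, h0] at hJ
  have : FiniteDimensional K (OreExt K) := Module.Finite.equiv (Submodule.quotEquivOfEqBot _ rfl)
  exact Module.Finite.not_linearIndependent_of_infinite (basis K) (basis K).linearIndependent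

/-- The differential space `U / J`, for a right ideal `J` of finite codimension. -/
def quotient (J : Submodule (OreExt K)ᵐᵒᵖ (OreExt K)) (hJ : FiniteCodim J) : FinDiffMod K where
  carrier := OreExt K ⧸ J.restrictScalars K
  finite := hJ
  der := QuotientAddGroup.map _ (J.restrictScalars K).toAddSubgroup (AddMonoidHom.mulRight Y)
    fun _ hu => mul_mem hu Y
  leibniz x m := by
    obtain ⟨u, rfl⟩ := Submodule.mkQ_surjective _ m
    exact congrArg (J.restrictScalars K).mkQ (smul_mul_Y x u)

/-- The class of `u` in `U / J`. -/
def toQuotient (J : Submodule (OreExt K)ᵐᵒᵖ (OreExt K)) (hJ : FiniteCodim J) :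
    OreExt K →ₗ[K] quotient J hJ := (J.restrictScalars K).mkQ

/-- The class of `1` is a cyclic generator of `U / J`: acting on it by `u` gives the class of `u`.
Only the powers of `Y` need checking, where `∂` is right multiplication by `Y`. -/
lemma act_quotient (J : Submodule (OreExt K)ᵐᵒᵖ (OreExt K)) (hJ : FiniteCodim J) :
    (quotient J hJ).act (toQuotient J hJ 1) = toQuotient J hJ := by
  refine (basis K).ext fun n => ?_
  rw [act_basis, basis_eq]
  induction n with
  | zero => rfl
  | succ n ih => rw [Function.iterate_succ_apply', ih, pow_succ]; rfl

end OreExt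

/-! ### The map `ζ`: injectivity, multiplicativity, image -/

namespace FiniteDual

/-- Every element of `U°` is the class of a pure tensor. -/
lemma exists_cls (z : FiniteDual K) :
    ∃ (M : FinDiffMod K) (φ : Module.Dual K M) (m : M), z = cls M φ m := by
  induction z using FiniteDual.induction_on with
  | zero => exact ⟨unit K, 0, 0, by simp [cls, preCls]⟩
  | cls M φ m => exact ⟨M, φ, m, rfl⟩
  | add a b ha hb =>
    obtain ⟨M, φ, m, rfl⟩ := ha
    obtain ⟨N, ψ, n, rfl⟩ := hb
    -- The vector `(m, n)` projects to `m` and to `n`, so the relations for the two projections turn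
    -- `φ ∘ fst ⊗ x + ψ ∘ snd ⊗ x` into `φ ⊗ m + ψ ⊗ n`.
    let x : M.prod N := (⟨m, n⟩ : M × N)
    refine ⟨M.prod N, φ ∘ₗ (Hom.fst M N).toLin + ψ ∘ₗ (Hom.snd M N).toLin, x, ?_⟩
    rw [add_cls, ← cls_hom, ← cls_hom]
    rfl

lemma ζ_cls_basis (M : FinDiffMod K) (φ : Module.Dual K M) (m : M) (n : ℕ) :
    ζ K (cls M φ m) (OreExt.basis K n) = φ (M.der^[n] m) := by
  rw [ζ_cls, act_basis]

/-- The defining relation for the inclusion of `m ◁ U` into `M` replaces `φ` by its restriction, and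
the values of that restriction are exactly the values of `ζ(φ ⊗ m)`. -/
lemma ζ_injective : Function.Injective (ζ K) := by
  rw [injective_iff_map_eq_zero]
  intro z hz
  obtain ⟨M, φ, m, rfl⟩ := exists_cls z
  have h0 : φ ∘ₗ (M.cyclicHom m).toLin = 0 := by
    ext a
    obtain ⟨_, u, rfl⟩ := a
    have h : ζ K (cls M φ m) u = 0 := by rw [hz]; rfl
    rw [ζ_cls] at h
    exact h
  have h1 : m = (M.cyclicHom m).toLin (M.cyclicGen m) := rfl
  rw [h1, cls_hom, h0, cls, preCls, TensorProduct.zero_tmul, map_zero, map_zero]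

lemma ζ_mul (a b : FiniteDual K) : ζ K (a * b) = ζ K a * ζ K b := by
  obtain ⟨M, φ, p, rfl⟩ := exists_cls a
  obtain ⟨N, ψ, q, rfl⟩ := exists_cls b
  -- The product in `U°` reverses the tensor factors to `q ⊗ p`; commutativity of the convolution
  -- product puts `ζ` of `ψ ⊗ q` first as well, so that the two binomial sums match term by term.
  rw [mul_comm (ζ K _), cls_mul_cls]
  refine UDual.ext_basis fun n => ?_
  rw [ζ_cls_basis, UDual.mul_basis, iter_tmul, map_sum]
  refine Finset.sum_congr rfl fun k _ => ?_
  rw [map_nsmul, diamond_tmul, ζ_cls_basis, ζ_cls_basis]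

/-- The value at `Yⁿ` is `x ∂ⁿ(1)`, which is zero for `n > 0`; this is `x ε`. With `ζ_target` it
gives linearity of `ζ` over `K ⊗ K`. -/
lemma ζ_source (x : K) : ζ K (source K x) = algebraMap K (UDual K) x := by
  refine UDual.ext_basis fun n => ?_
  refine (ζ_cls_basis _ _ _ n).trans ?_
  rw [Algebra.algebraMap_eq_smul_one, WithConv.ofConv_smul, LinearMap.smul_apply,
    LinearMap.convOne_apply, UDual.counit_basis]
  change x * (fun z : K => z′)^[n] 1 = x * _
  cases n with
  | zero => simp
  | succ n => simp [Function.iterate_succ_apply]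

lemma ζ_target (x : K) : ζ K (target K x) = UDual.μ K x := by
  refine UDual.ext_basis fun n => ?_
  refine (ζ_cls_basis _ _ _ n).trans ?_
  refine Eq.trans ?_ (UDual.actK_basis x n).symm
  exact one_mul ((fun z : K => z′)^[n] x)

lemma ζ_one : ζ K 1 = 1 :=
  (congrArg (ζ K) (map_one (source K)).symm).trans
    ((ζ_source (1 : K)).trans (map_one (algebraMap K (UDual K))))

variable (K) in
/-- The canonical map `ζ` as a homomorphism of `(K ⊗ K)`-algebras. -/
def ζAlgHom : FiniteDual K →ₐ[K ⊗[Constants K] K] UDual K where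
  toFun := ζ K
  map_one' := ζ_one
  map_mul' := ζ_mul
  map_zero' := map_zero _
  map_add' := map_add _
  commutes' t := by
    induction t with
    | zero => simp only [map_zero]
    | add a b ha hb => simp only [map_add] at ha hb ⊢; rw [ha, hb]
    | tmul x y =>
      refine (ζ_mul (source K x) (target K y)).trans ?_
      rw [ζ_source, ζ_target]
      rfl

/-- For `z = φ ⊗ m` the annihilator of `m` serves as the ideal. -/
lemma ζ_vanishes (z : FiniteDual K) : ∃ J : Submodule (OreExt K)ᵐᵒᵖ (OreExt K),
    FiniteCodim J ∧ ∀ u ∈ J, ζ K z u = 0 := by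
  obtain ⟨M, φ, m, rfl⟩ := exists_cls z
  refine ⟨M.annihilator m, M.finiteCodim_annihilator m, fun u hu => ?_⟩
  have h : M.act m u = 0 := hu
  rw [ζ_cls, h, map_zero]

/-- The functional descends to `φ` on `U / J`, and `φ(1 ◁ u)` is the value of `φ` at the class of
`u`, that is, `f u`. -/
lemma exists_ζ_eq {J : Submodule (OreExt K)ᵐᵒᵖ (OreExt K)} (hJ : FiniteCodim J) (f : UDual K)
    (hf : ∀ u ∈ J, f u = 0) : ∃ z, ζ K z = f := by
  let φ : Module.Dual K (OreExt.quotient J hJ) := (J.restrictScalars K).liftQ f.ofConv hf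
  refine ⟨cls _ φ (OreExt.toQuotient J hJ 1), UDual.ext_basis fun n => ?_⟩
  rw [ζ_cls, OreExt.act_quotient]
  rfl

end FiniteDual

/-! ### Passage to principal ideals, and the conclusion -/

/-- A functional that vanishes on a right ideal of finite codimension vanishes on a principal one. -/
lemma exists_isPrincipal_of_finiteCodim {J : Submodule (OreExt K)ᵐᵒᵖ (OreExt K)}
    (hJ : FiniteCodim J) : ∃ I ≤ J, I.IsPrincipal ∧ FiniteCodim I := by
  obtain ⟨P, hPJ, hP⟩ := OreExt.exists_ne_zero_of_finiteCodim hJ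
  exact ⟨Submodule.span _ {P}, (Submodule.span_singleton_le_iff_mem P J).2 hPJ, ⟨P, rfl⟩,
    OreExt.finiteCodim_of_mem hP (Submodule.mem_span_singleton_self P)⟩

end

end DiffOps

theorem corollary2 {K : Type*} [Field K] [Differential K] :
    ∃ S : Subalgebra (K ⊗[DiffOps.Constants K] K) (DiffOps.UDual K),
      (∀ f : DiffOps.UDual K, f ∈ S ↔
        ∃ J : Submodule (DiffOps.OreExt K)ᵐᵒᵖ (DiffOps.OreExt K),
          J.IsPrincipal ∧ DiffOps.FiniteCodim J ∧ ∀ u ∈ J, f u = 0) ∧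
      (∀ f : DiffOps.UDual K, f ∈ S ↔
        ∃ J : Submodule (DiffOps.OreExt K)ᵐᵒᵖ (DiffOps.OreExt K),
          DiffOps.FiniteCodim J ∧ ∀ u ∈ J, f u = 0) ∧
      ∃ e : DiffOps.FiniteDual K ≃ₐ[K ⊗[DiffOps.Constants K] K] S,
        ∀ z : DiffOps.FiniteDual K, (e z : DiffOps.UDual K) = DiffOps.ζ K z := by
  refine ⟨(DiffOps.FiniteDual.ζAlgHom K).range, fun f => ⟨?_, ?_⟩, fun f => ⟨?_, ?_⟩,
    AlgEquiv.ofInjective (DiffOps.FiniteDual.ζAlgHom K) DiffOps.FiniteDual.ζ_injective,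
    fun z => rfl⟩
  · rintro ⟨z, rfl⟩
    obtain ⟨J, hJ, hz⟩ := DiffOps.FiniteDual.ζ_vanishes z
    obtain ⟨I, hIJ, hI, hfin⟩ := DiffOps.exists_isPrincipal_of_finiteCodim hJ
    exact ⟨I, hI, hfin, fun u hu => hz u (hIJ hu)⟩
  · rintro ⟨J, -, hJ, hf⟩
    exact DiffOps.FiniteDual.exists_ζ_eq hJ f hf
  · rintro ⟨z, rfl⟩
    exact DiffOps.FiniteDual.ζ_vanishes z
  · rintro ⟨J, hJ, hf⟩
    exact DiffOps.FiniteDual.exists_ζ_eq hJ f hf
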